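/- Let $n\ge 1$ and let $x^{(n)}=f(x,\dots,x^{(n-1)},t)+G(x,\dots,x^{(n-1)},t)\,u$, $t\ge 0$, be a smooth real system with $x(t)\in\mathbb R^N$ and input $u(t)\in\mathbb R^M$. Let $p$ be a number of levels, $C\subseteq\{1,\dots,p\}$ the set of levels with a complex contraction rate, and $p+|C|=n$. Level $j$ has the state space $S_j=\mathbb C^N$ if $j\in C$ and $S_j=\mathbb R^N$ if $j\notin C$. Let $\Lambda_j(z_j,t)$ be integrable $N\times N$ contraction rate matrices on $S_j\times[0,\infty)$ (complex for $j\in C$, real for $j\notin C$): for each $j$ there is an open integral $F_j(z_j,t)=\int\Lambda_j\,dz_j\in S_j$, i.e. $\partial F_j/\partial z_j=\Lambda_j$ (with $F_j$ holomorphic in $z_j$ if $j\in C$). It is unique up to an integration constant $c_j(t)\in S_j$. A function $x$ satisfies the generalized characteristic equation $$\Big(\tfrac{d}{dt}-\int\Lambda_p\,d\Big)\Re\cdots\Big(\tfrac{d}{dt}-\int\Lambda_1\,d\Big)x=0$$ if there are differentiable $z_j:[0,\infty)\to S_j$ with $\Re z_1=x$ and $\dot z_j-F_j(z_j,t)=\Re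 z_{j+1}$ for $j=1,\dots,p$, where $z_{p+1}=0$. A controller enforces the equation if all motions $x:[0,\infty)\to\mathbb R^N$ of the closed loop satisfy it. Let $\lambda_{\max}(A)$, $\lambda_{\min}(A)$ be the largest and smallest eigenvalue of the Hermitian part $\frac12(A+A^{*T})$. (1) For every choice of the integration constants, a controller that enforces the characteristic equation gives global contraction behaviour with the rates $\Lambda_j(z_j,t)$, in the following sense. (a) Virtual displacements $\delta z_j=\partial z_j/\partial s$ of $C^2$ one-parameter families of hierarchies of closed-loop motions satisfy $\frac{d}{dt}\delta z_j=\Lambda_j(z_j,t)\,\delta z_j+\Re\,\delta z_{j+1}$, and $$\lambda_{\min}(\Lambda_j)\|\delta z_j\|^2\le\tfrac12\tfrac{d}{dt}\|\delta z_j\|^2-\Re\langle\delta z_j,\Re\,\delta z_{j+1}\rangle\le\lambda_{\max}(\Lambda_j)\|\delta z_j\|^2 .$$ (b) For two closed-loop motions $x,y$ with hierarchies $z,w$ and $d_j=z_j-w_j$, the same bounds hold for $d_j$ in place of $\delta z_j$, with any lower bound of $\lambda_{\min}(\Lambda_j(\cdot,t))$ and any upper bound of $\lambda_{\max}(\Lambda_j(\cdot,t))$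 on the segment from $z_j(t)$ to $w_j(t)$. If $\lambda_{\max}(\Lambda_j(\cdot,t))\le L(t)$ on these segments for all $t\ge0$, with $L$ continuous, then $$\|d_j(t)\|\le e^{\int_0^tL}\|d_j(0)\|+\int_0^te^{\int_\tau^tL}\|\Re d_{j+1}(\tau)\|\,d\tau .$$ (c) If one continuous $L$ serves for all $j$, then $\|d_j(t)\|\le e^{\int_0^tL}\sum_{i\ge j}\frac{t^{i-j}}{(i-j)!}\|d_i(0)\|$ for all $j$, and $\|x(t)-y(t)\|\le e^{\int_0^tL}\sum_{i}\frac{t^{i-1}}{(i-1)!}\|d_i(0)\|$. (d) If $\lambda_{\max}(\Lambda_j)\le-\alpha$ on $S_j\times[0,\infty)$ for all $j$, then for every $\beta<\alpha$: $\|d_j(t)\|\le e^{-\beta t}\sum_{i\ge j}(\alpha-\beta)^{-(i-j)}\|d_i(0)\|$ for all $j$, and $\|x(t)-y(t)\|\le e^{-\beta t}\sum_i(\alpha-\beta)^{-(i-1)}\|d_i(0)\|$. So all motions converge exponentially to each other if $\alpha>0$. (2) The integration constants can be used for tracking without changing this: for every smooth desired trajectory $x_d:[0,\infty)\to\mathbb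 R^N$ there are integration constants $c_j(t)$ such that $x_d$ satisfies the characteristic equation with $F_j+c_j$ in place of $F_j$; and if a controller enforces that equation, then (a)--(d) hold, with the same $\Lambda_j$, for the closed-loop motions together with $x_d$. If the $F_j$ are jointly smooth in $(z_j,t)$ then the $c_j$ can be chosen smooth, and if moreover all rates are real then only $c_p$ has to be non-zero. -/

import Mathlib

open Set
open scoped ContDiff

noncomputable section

/-- Real `N`-dimensional Euclidean space. -/
abbrev RVec (N : ℕ) := EuclideanSpace ℝ (Fin N)

/-- Complex `N`-dimensional Hermitian space. -/
abbrev CVec (N : ℕ) := EuclideanSpace ℂ (Fin N)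

/-- Componentwise real part. -/
def rePart {N : ℕ} (z : CVec N) : RVec N := WithLp.toLp 2 (fun i => (z i).re)

/-- A real vector regarded as a complex one. -/
def toCVec {N : ℕ} (x : RVec N) : CVec N := WithLp.toLp 2 (fun i => ((x i : ℝ) : ℂ))

/-! ### The plant and its controllers -/

/-- A smooth `n`-th order real system in controllability form
`x^(n) = f(x, …, x^(n-1), t) + G(x, …, x^(n-1), t) u`, considered for `t ≥ 0`. -/
structure ControlSystem (n N M : ℕ) where
  f : (Fin n → RVec N) → ℝ → RVec N
  G : (Fin n → RVec N) → ℝ → (RVec M →L[ℝ] RVec N)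
  smooth_f : ContDiffOn ℝ ∞ (fun q : (Fin n → RVec N) × ℝ => f q.1 q.2) (univ ×ˢ Ici 0)
  smooth_G : ContDiffOn ℝ ∞ (fun q : (Fin n → RVec N) × ℝ => G q.1 q.2) (univ ×ˢ Ici 0)

/-- The vector `(x, x', …, x^(n-1))` at time `t`. -/
def jet (n : ℕ) {N : ℕ} (x : ℝ → RVec N) (t : ℝ) : Fin n → RVec N :=
  fun k => iteratedDerivWithin k x (Ici 0) t

/-- `x` is a motion of the plant on `[0, ∞)` under the control input `u`. -/
def ControlSystem.IsTrajectory {n N M : ℕ} (sys : ControlSystem n N M)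
    (x : ℝ → RVec N) (u : ℝ → RVec M) : Prop :=
  ContDiffOn ℝ n x (Ici 0) ∧
    ∀ t, 0 ≤ t → iteratedDerivWithin n x (Ici 0) t =
      sys.f (jet n x t) t + sys.G (jet n x t) t (u t)

/-- A controller, in the most general sense: it says which input signals may accompany a motion.
A static feedback `u = k(x, …, x^(n-1), t)` is `fun x => {u | ∀ t, 0 ≤ t → u t = k (jet n x t) t}`;
for a dynamic feedback the input signals also run over the internal states. -/
abbrev Controller (N M : ℕ) := (ℝ → RVec N) → Set (ℝ → RVec M)

/-- The motions of the closed loop. -/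
def closedLoop {n N M : ℕ} (sys : ControlSystem n N M) (K : Controller N M) :
    Set (ℝ → RVec N) :=
  {x | ∃ u ∈ K x, sys.IsTrajectory x u}

/-! ### Contraction rates, open integrals and the characteristic equation

There are `p` levels `j : Fin p`. Those in `C` carry a complex contraction rate matrix, and a
complex state `z_j`; the other ones carry a real matrix and a real state. -/

/-- The state space of level `j`: all of `ℂ^N` if `j ∈ C`, and `ℝ^N` (inside `ℂ^N`) otherwise. -/
def stateSpace {p : ℕ} (C : Finset (Fin p)) (N : ℕ) (j : Fin p) : Set (CVec N) :=
  {z | j ∉ C → ∀ i, (z i).im = 0}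

/-- Matrices `Λ_j(z_j, t)`. -/
abbrev Rates (p N : ℕ) := Fin p → CVec N → ℝ → Matrix (Fin N) (Fin N) ℂ

/-- Vector fields `F_j(z_j, t)`. -/
abbrev Fields (p N : ℕ) := Fin p → CVec N → ℝ → CVec N

/-- `F_j(z_j, t) = ∫ Λ_j(z_j, t) dz_j` is an open integral of `Λ_j` for every level `j`: at fixed
time the Jacobian of `F_j` is `Λ_j`. At a complex level the derivative is complex linear, that is,
`F_j` is holomorphic in `z_j`; at a real level `Λ_j` and `F_j` are real and the derivative is
taken along `ℝ^N`. -/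
structure IsOpenIntegral {p N : ℕ} (C : Finset (Fin p)) (Λ : Rates p N) (F : Fields p N) :
    Prop where
  real_rate : ∀ j, j ∉ C → ∀ z ∈ stateSpace C N j, ∀ t, 0 ≤ t → ∀ i k, (Λ j z t i k).im = 0
  real_field : ∀ j, j ∉ C → ∀ z ∈ stateSpace C N j, ∀ t, 0 ≤ t → F j z t ∈ stateSpace C N j
  jacobian : ∀ j, ∀ z ∈ stateSpace C N j, ∀ t, 0 ≤ t →
    HasFDerivWithinAt (fun ζ => F j ζ t)
      ((Matrix.toEuclideanCLM (n := Fin N) (𝕜 := ℂ) (Λ j z t)).restrictScalars ℝ)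
      (stateSpace C N j) z

/-- Time-varying integration constants `c_j(t)`, real at the real levels. -/
def IsIntegrationConstant {p N : ℕ} (C : Finset (Fin p)) (c : Fin p → ℝ → CVec N) : Prop :=
  ∀ j t, 0 ≤ t → c j t ∈ stateSpace C N j

/-- The open integral with the integration constants `c_j(t)` added. -/
def addConst {p N : ℕ} (F : Fields p N) (c : Fin p → ℝ → CVec N) : Fields p N :=
  fun j z t => F j z t + c j t

/-- `F_j(z_j, t)` is jointly smooth in the state and the time. -/
def SmoothFields {p N : ℕ} (C : Finset (Fin p)) (F : Fields p N) : Prop :=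
  ∀ j, ContDiffOn ℝ ∞ (fun q : CVec N × ℝ => F j q.1 q.2) (stateSpace C N j ×ˢ Ici 0)

/-- The coupling term `Re z_{j+1}` of level `j`, with `z_{p+1} = 0`. -/
def nextRe {p N : ℕ} (z : Fin p → CVec N) (j : Fin p) : CVec N :=
  if h : (j : ℕ) + 1 < p then toCVec (rePart (z ⟨(j : ℕ) + 1, h⟩)) else 0

/-- The operator `(d/dt - ∫ Λ_j d)` applied to `z_j`. -/
def rateOp {p N : ℕ} (F : Fields p N) (j : Fin p) (z : ℝ → CVec N) (t : ℝ) : CVec N :=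
  derivWithin z (Ici 0) t - F j (z t) t

/-- `z` is a hierarchy of states for `x`:
`Re z_1 = x`, `Re z_{j+1} = (d/dt - ∫ Λ_j d) z_j` and `(d/dt - ∫ Λ_p d) z_p = 0`. -/
structure IsHierarchy {p N : ℕ} (C : Finset (Fin p)) (F : Fields p N)
    (x : ℝ → RVec N) (z : Fin p → ℝ → CVec N) : Prop where
  first : ∀ j : Fin p, (j : ℕ) = 0 → ∀ t, 0 ≤ t → rePart (z j t) = x t
  mem : ∀ j t, 0 ≤ t → z j t ∈ stateSpace C N j
  diff : ∀ j, DifferentiableOn ℝ (z j) (Ici 0)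
  step : ∀ j t, 0 ≤ t → rateOp F j (z j) t = nextRe (fun i => z i t) j

/-- The generalized characteristic equation
`(d/dt - ∫ Λ_p d) Re ⋯ (d/dt - ∫ Λ_1 d) x = 0` for `x`. -/
def CharacteristicEq {p N : ℕ} (C : Finset (Fin p)) (F : Fields p N) (x : ℝ → RVec N) : Prop :=
  ∃ z, IsHierarchy C F x z

/-- The controller enforces the characteristic equation. -/
def Enforces {n N M p : ℕ} (sys : ControlSystem n N M) (K : Controller N M)
    (C : Finset (Fin p)) (F : Fields p N) : Prop :=
  ∀ x ∈ closedLoop sys K, CharacteristicEq C F x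

/-! ### Contraction -/

/-- The Hermitian part of a matrix. -/
def hermPart {N : ℕ} (A : Matrix (Fin N) (Fin N) ℂ) : Matrix (Fin N) (Fin N) ℂ :=
  (1 / 2 : ℂ) • (A + A.conjTranspose)

theorem hermPart_isHermitian {N : ℕ} (A : Matrix (Fin N) (Fin N) ℂ) :
    (hermPart A).IsHermitian := by
  unfold hermPart Matrix.IsHermitian
  rw [Matrix.conjTranspose_smul, Matrix.conjTranspose_add, Matrix.conjTranspose_conjTranspose,
    add_comm]
  simp

/-- The largest eigenvalue of the Hermitian part. -/
def lamMax {N : ℕ} (A : Matrix (Fin N) (Fin N) ℂ) : ℝ :=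
  ⨆ i, (hermPart_isHermitian A).eigenvalues i

/-- The smallest eigenvalue of the Hermitian part. -/
def lamMin {N : ℕ} (A : Matrix (Fin N) (Fin N) ℂ) : ℝ :=
  ⨅ i, (hermPart_isHermitian A).eigenvalues i

/-- The length `s = ‖d‖`, driven by `w`, changes at time `t` with a rate between `lo` and `hi`:
`lo s² + Re ⟨d, w⟩ ≤ s ds/dt ≤ hi s² + Re ⟨d, w⟩`. For `w = 0` and `s ≠ 0` this is
`lo ≤ (ds/dt) / s ≤ hi`. -/
def RateBounds {N : ℕ} (d : ℝ → CVec N) (w : CVec N) (lo hi t : ℝ) : Prop :=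
  ∃ r : ℝ, HasDerivWithinAt (fun τ => ‖d τ‖ ^ 2) (2 * r) (Ici 0) t ∧
    lo * ‖d t‖ ^ 2 + (inner ℂ (d t) w).re ≤ r ∧ r ≤ hi * ‖d t‖ ^ 2 + (inner ℂ (d t) w).re

/-- The virtual displacement `δz_j = ∂z_j/∂s` of a family `Z s` of hierarchies. -/
def virtualDisp {p N : ℕ} (Z : ℝ → Fin p → ℝ → CVec N) (s : ℝ) (j : Fin p) (t : ℝ) : CVec N :=
  deriv (fun σ => Z σ j t) s

/-- The motions `X`, with hierarchies of states given by `H`, show global contraction behaviour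
with the rates `Λ_j(z_j, t)`. -/
structure GlobalContraction {p N : ℕ} (C : Finset (Fin p)) (Λ : Rates p N)
    (X : Set (ℝ → RVec N)) (H : (ℝ → RVec N) → (Fin p → ℝ → CVec N) → Prop) : Prop where
  /-- Every motion has a hierarchy of states. -/
  coords : ∀ x ∈ X, ∃ z, H x z
  /-- Virtual dynamics `d/dt δz_j = Λ_j δz_j + Re δz_{j+1}`, with the bounds for the differential
  length that come from the extreme eigenvalues of the Hermitian part of `Λ_j`. -/
  virtual : ∀ (ξ : ℝ → ℝ → RVec N) (Z : ℝ → Fin p → ℝ → CVec N),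
    (∀ s, ξ s ∈ X ∧ H (ξ s) (Z s)) →
    (∀ j, ContDiffOn ℝ 2 (fun q : ℝ × ℝ => Z q.1 j q.2) (univ ×ˢ Ici 0)) →
    ∀ s j t, 0 ≤ t →
      HasDerivWithinAt (virtualDisp Z s j)
        (Matrix.toEuclideanCLM (n := Fin N) (𝕜 := ℂ) (Λ j (Z s j t) t) (virtualDisp Z s j t)
          + nextRe (fun i => virtualDisp Z s i t) j) (Ici 0) t ∧
      RateBounds (virtualDisp Z s j) (nextRe (fun i => virtualDisp Z s i t) j)
        (lamMin (Λ j (Z s j t) t)) (lamMax (Λ j (Z s j t) t)) t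
  /-- Finite distances: the rate of change of the distance of two motions at level `j` is bounded
  by the extreme eigenvalues along the connecting shortest path. -/
  finite : ∀ x ∈ X, ∀ y ∈ X, ∀ z w, H x z → H y w → ∀ j t, 0 ≤ t → ∀ lo hi : ℝ,
    (∀ ζ ∈ segment ℝ (z j t) (w j t), lo ≤ lamMin (Λ j ζ t) ∧ lamMax (Λ j ζ t) ≤ hi) →
    RateBounds (fun τ => z j τ - w j τ) (nextRe (fun i => z i t - w i t) j) lo hi t
  /-- The integrated form of the bound from above at level `j`. -/
  level : ∀ x ∈ X, ∀ y ∈ X, ∀ z w, H x z → H y w → ∀ j, ∀ L : ℝ → ℝ, ContinuousOn L (Ici 0) →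
    (∀ t, 0 ≤ t → ∀ ζ ∈ segment ℝ (z j t) (w j t), lamMax (Λ j ζ t) ≤ L t) →
    ∀ t, 0 ≤ t →
      ‖z j t - w j t‖ ≤ Real.exp (∫ τ in (0 : ℝ)..t, L τ) * ‖z j 0 - w j 0‖ +
        ∫ τ in (0 : ℝ)..t, Real.exp (∫ σ in τ..t, L σ) * ‖nextRe (fun i => z i τ - w i τ) j‖
  /-- The whole hierarchy, and the motions themselves. -/
  cascade : ∀ x ∈ X, ∀ y ∈ X, ∀ z w, H x z → H y w → ∀ L : ℝ → ℝ, ContinuousOn L (Ici 0) →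
    (∀ j t, 0 ≤ t → ∀ ζ ∈ segment ℝ (z j t) (w j t), lamMax (Λ j ζ t) ≤ L t) →
    ∀ t, 0 ≤ t →
      (∀ j, ‖z j t - w j t‖ ≤ Real.exp (∫ τ in (0 : ℝ)..t, L τ) *
        ∑ i ∈ Finset.Ici j, t ^ ((i : ℕ) - j) / (Nat.factorial ((i : ℕ) - j)) * ‖z i 0 - w i 0‖) ∧
      ‖x t - y t‖ ≤ Real.exp (∫ τ in (0 : ℝ)..t, L τ) *
        ∑ i : Fin p, t ^ (i : ℕ) / (Nat.factorial i) * ‖z i 0 - w i 0‖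
  /-- Uniform exponential convergence of all motions to each other, with every rate `β < α`, if the
  eigenvalues of the Hermitian parts are at most `-α` everywhere. -/
  exponential : ∀ α : ℝ,
    (∀ j, ∀ ζ ∈ stateSpace C N j, ∀ t, 0 ≤ t → lamMax (Λ j ζ t) ≤ -α) →
    ∀ β, β < α → ∀ x ∈ X, ∀ y ∈ X, ∀ z w, H x z → H y w → ∀ t, 0 ≤ t →
      (∀ j, ‖z j t - w j t‖ ≤ Real.exp (-β * t) *
        ∑ i ∈ Finset.Ici j, ((α - β)⁻¹) ^ ((i : ℕ) - j) * ‖z i 0 - w i 0‖) ∧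
      ‖x t - y t‖ ≤ Real.exp (-β * t) *
        ∑ i : Fin p, ((α - β)⁻¹) ^ (i : ℕ) * ‖z i 0 - w i 0‖

end

/-! ### Numerical range of a matrix -/

/-! The plant plays no role beyond supplying a set of motions, each with a hierarchy of states. For
two hierarchies, `d = z_j - w_j` satisfies `d' = F_j(z_j) - F_j(w_j) + Re d_{j+1}`. Pairing with `d`
and applying the scalar mean value theorem along the segment (`IsOpenIntegral.exists_re_inner_eq`)
replaces the difference of the fields by `Λ_j(ζ) d` at one point `ζ`. Its numerical range lies
between the extreme eigenvalues of the Hermitian part. This bounds the growth of `‖d‖²`, and a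
Gronwall argument (`norm_le_of_rateBounds`) integrates the upper bound. Taking real parts does not
increase norms, so the levels form a triangular cascade, solved from the last level down
(`cascade_bound`, `exponential_cascade_bound`). The virtual dynamics come from differentiating the
hierarchy equations in the family parameter and exchanging mixed derivatives.

Integration constants leave the Jacobians alone, so the same argument applies to `addConst F c`. For
tracking, the states are prescribed and the equations solved for `c`. The desired trajectory then
has a hierarchy of its own and can be adjoined to the closed-loop motions. -/

/-- The skew-Hermitian part contributes only an imaginary number to the quadratic form. -/
theorem re_inner_hermPart {N : ℕ} (A : Matrix (Fin N) (Fin N) ℂ) (v : CVec N) :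
    (inner ℂ v (Matrix.toEuclideanCLM (n := Fin N) (𝕜 := ℂ) (hermPart A) v)).re =
      (inner ℂ v (Matrix.toEuclideanCLM (n := Fin N) (𝕜 := ℂ) A v)).re := by
  have h : inner ℂ v (Matrix.toEuclideanCLM (n := Fin N) (𝕜 := ℂ) A.conjTranspose v) =
      inner ℂ (Matrix.toEuclideanCLM (n := Fin N) (𝕜 := ℂ) A v) v := by
    rw [← Matrix.star_eq_conjTranspose, map_star, ContinuousLinearMap.star_eq_adjoint,
      ContinuousLinearMap.adjoint_inner_right]
  have h2 : (inner ℂ (Matrix.toEuclideanCLM (n := Fin N) (𝕜 := ℂ) A v) v).re =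
      (inner ℂ v (Matrix.toEuclideanCLM (n := Fin N) (𝕜 := ℂ) A v)).re := by
    rw [← inner_conj_symm, Complex.conj_re]
  have h3 : ((1 / 2 : ℂ)) = ((1 / 2 : ℝ) : ℂ) := by push_cast; rfl
  unfold hermPart
  rw [map_smul, map_add, smul_apply, add_apply,
    inner_smul_right, inner_add_right, h, h3, Complex.re_ofReal_mul, Complex.add_re, h2]
  ring

/-- Parseval in an orthonormal eigenbasis diagonalises the quadratic form. Both eigenvalue bounds
follow by comparing it with `‖v‖²` termwise. -/
theorem re_inner_eq_sum_eigenvalues {N : ℕ} {A : Matrix (Fin N) (Fin N) ℂ} (hA : A.IsHermitian)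
    (v : CVec N) :
    (inner ℂ v (Matrix.toEuclideanCLM (n := Fin N) (𝕜 := ℂ) A v)).re =
      ∑ i, hA.eigenvalues i * ‖inner ℂ (hA.eigenvectorBasis i) v‖ ^ 2 := by
  rw [← OrthonormalBasis.sum_inner_mul_inner hA.eigenvectorBasis, Complex.re_sum]
  refine Finset.sum_congr rfl fun i _ => ?_
  have hb : Matrix.toEuclideanCLM (n := Fin N) (𝕜 := ℂ) A (hA.eigenvectorBasis i) =
      ((hA.eigenvalues i : ℝ) : ℂ) • hA.eigenvectorBasis i := by
    ext k
    rw [Matrix.ofLp_toEuclideanCLM, hA.mulVec_eigenvectorBasis]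
    simp
  have hs : inner ℂ (hA.eigenvectorBasis i) (Matrix.toEuclideanCLM (n := Fin N) (𝕜 := ℂ) A v) =
      ((hA.eigenvalues i : ℝ) : ℂ) * inner ℂ (hA.eigenvectorBasis i) v := by
    rw [← ContinuousLinearMap.adjoint_inner_left, ← ContinuousLinearMap.star_eq_adjoint, ← map_star,
      Matrix.star_eq_conjTranspose, hA.eq, hb, inner_smul_left, Complex.conj_ofReal]
  rw [hs, mul_left_comm, Complex.re_ofReal_mul, ← inner_conj_symm v, Complex.conj_mul']
  norm_cast

theorem re_inner_le_lamMax {N : ℕ} (A : Matrix (Fin N) (Fin N) ℂ) (v : CVec N) :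
    (inner ℂ v (Matrix.toEuclideanCLM (n := Fin N) (𝕜 := ℂ) A v)).re ≤ lamMax A * ‖v‖ ^ 2 := by
  rw [← re_inner_hermPart, re_inner_eq_sum_eigenvalues (hermPart_isHermitian A),
    ← OrthonormalBasis.sum_sq_norm_inner_right (hermPart_isHermitian A).eigenvectorBasis v,
    Finset.mul_sum]
  exact Finset.sum_le_sum fun i _ => mul_le_mul_of_nonneg_right
    (le_ciSup (Set.finite_range _).bddAbove i) (by positivity)

theorem lamMin_le_re_inner {N : ℕ} (A : Matrix (Fin N) (Fin N) ℂ) (v : CVec N) :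
    lamMin A * ‖v‖ ^ 2 ≤ (inner ℂ v (Matrix.toEuclideanCLM (n := Fin N) (𝕜 := ℂ) A v)).re := by
  rw [← re_inner_hermPart, re_inner_eq_sum_eigenvalues (hermPart_isHermitian A),
    ← OrthonormalBasis.sum_sq_norm_inner_right (hermPart_isHermitian A).eigenvectorBasis v,
    Finset.mul_sum]
  exact Finset.sum_le_sum fun i _ => mul_le_mul_of_nonneg_right
    (ciInf_le (Set.finite_range _).bddBelow i) (by positivity)

/-! ### The state spaces and the coupling term -/

theorem norm_rePart_le {N : ℕ} (z : CVec N) : ‖rePart z‖ ≤ ‖z‖ := by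
  rw [EuclideanSpace.norm_eq, EuclideanSpace.norm_eq]
  refine Real.sqrt_le_sqrt (Finset.sum_le_sum fun i _ => ?_)
  exact pow_le_pow_left₀ (norm_nonneg _) (Complex.abs_re_le_norm (z i)) 2

theorem norm_toCVec {N : ℕ} (x : RVec N) : ‖toCVec x‖ = ‖x‖ := by
  simp [EuclideanSpace.norm_eq, toCVec]

theorem rePart_toCVec {N : ℕ} (x : RVec N) : rePart (toCVec x) = x := by
  ext i; simp [rePart, toCVec]

theorem rePart_sub {N : ℕ} (z w : CVec N) : rePart (z - w) = rePart z - rePart w := by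
  ext i; simp [rePart]

/-- A real vector regarded as a complex one, as a continuous linear map. -/
noncomputable def toCVecCLM (N : ℕ) : RVec N →L[ℝ] CVec N :=
  LinearMap.mkContinuous
    { toFun := toCVec
      map_add' := fun x y => by ext i; simp [toCVec]
      map_smul' := fun a x => by ext i; simp [toCVec] } 1
    (fun x => by simp [norm_toCVec])

/-- The projection onto the real vectors, as a continuous linear map. -/
noncomputable def realProj (N : ℕ) : CVec N →L[ℝ] CVec N :=
  LinearMap.mkContinuous
    { toFun := fun z => toCVec (rePart z)
      map_add' := fun x y => by ext i; simp [toCVec, rePart]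
      map_smul' := fun a x => by ext i; simp [toCVec, rePart] } 1
    (fun x => by simpa [norm_toCVec] using norm_rePart_le x)

theorem realProj_apply {N : ℕ} (z : CVec N) : realProj N z = toCVec (rePart z) := rfl

theorem nextRe_of_lt {p N : ℕ} (z : Fin p → CVec N) (j : Fin p) (h : (j : ℕ) + 1 < p) :
    nextRe z j = realProj N (z ⟨(j : ℕ) + 1, h⟩) := by
  simp [nextRe, h, realProj_apply]

theorem nextRe_of_not_lt {p N : ℕ} (z : Fin p → CVec N) (j : Fin p) (h : ¬ (j : ℕ) + 1 < p) :
    nextRe z j = 0 := by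
  simp [nextRe, h]

theorem nextRe_sub {p N : ℕ} (z w : Fin p → CVec N) (j : Fin p) :
    nextRe (fun i => z i - w i) j = nextRe z j - nextRe w j := by
  by_cases h : (j : ℕ) + 1 < p
  · simp only [nextRe_of_lt _ _ h, map_sub]
  · simp [nextRe_of_not_lt _ _ h]

/-- The coupling has gain at most one, so no extra constants appear in the cascade estimates. -/
theorem norm_nextRe_le {p N : ℕ} (z : Fin p → CVec N) (j : Fin p) (h : (j : ℕ) + 1 < p) :
    ‖nextRe z j‖ ≤ ‖z ⟨(j : ℕ) + 1, h⟩‖ := by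
  rw [nextRe_of_lt _ _ h, realProj_apply, norm_toCVec]
  exact norm_rePart_le _

theorem continuousOn_nextRe {p N : ℕ} {z : Fin p → ℝ → CVec N} {s : Set ℝ}
    (hz : ∀ i, ContinuousOn (z i) s) (j : Fin p) :
    ContinuousOn (fun t => nextRe (fun i => z i t) j) s := by
  by_cases h : (j : ℕ) + 1 < p
  · simp only [nextRe_of_lt _ _ h]
    exact (realProj N).continuous.comp_continuousOn (hz _)
  · simp only [nextRe_of_not_lt _ _ h]
    exact continuousOn_const

/-- The state space as a real subspace. -/
def stateSubmodule {p : ℕ} (C : Finset (Fin p)) (N : ℕ) (j : Fin p) : Submodule ℝ (CVec N) where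
  carrier := stateSpace C N j
  zero_mem' := fun _ _ => by simp
  add_mem' := fun ha hb hj i => by simp [ha hj i, hb hj i]
  smul_mem' := fun c x hx hj i => by simp [hx hj i]

theorem toCVec_mem_stateSpace {p : ℕ} (C : Finset (Fin p)) {N : ℕ} (j : Fin p) (x : RVec N) :
    toCVec x ∈ stateSpace C N j := fun _ i => by simp [toCVec]

theorem nextRe_mem_stateSpace {p : ℕ} (C : Finset (Fin p)) {N : ℕ} (z : Fin p → CVec N)
    (j k : Fin p) : nextRe z j ∈ stateSpace C N k := by
  unfold nextRe
  split
  · exact toCVec_mem_stateSpace _ _ _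
  · exact (stateSubmodule C N k).zero_mem

/-- At a real level the imaginary parts vanish identically on `[0, ∞)`, and one-sided derivatives
there are unique. -/
theorem derivWithin_mem_stateSpace {p : ℕ} (C : Finset (Fin p)) {N : ℕ} (j : Fin p)
    {z : ℝ → CVec N} (hz : ∀ t, 0 ≤ t → z t ∈ stateSpace C N j)
    (hd : DifferentiableOn ℝ z (Ici 0)) (t : ℝ) (ht : 0 ≤ t) :
    derivWithin z (Ici 0) t ∈ stateSpace C N j := by
  intro hj i
  have h1 : HasDerivWithinAt (fun τ => ((z τ) i).im) ((derivWithin z (Ici 0) t) i).im (Ici 0) t :=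
    (Complex.imCLM.comp ((EuclideanSpace.proj (𝕜 := ℂ) i).restrictScalars ℝ)).hasFDerivAt
      |>.comp_hasDerivWithinAt t (hd t ht).hasDerivWithinAt
  have h2 : HasDerivWithinAt (fun τ => ((z τ) i).im) 0 (Ici 0) t :=
    (hasDerivWithinAt_const t (Ici 0) (0 : ℝ)).congr (fun τ hτ => hz τ hτ hj i) (hz t ht hj i)
  exact (uniqueDiffOn_Ici (0 : ℝ) t ht).eq_deriv _ h1 h2

/-- The added term depends on time only, so it is invisible to the Jacobian in the state. This is
why integration constants are free for tracking. -/
theorem IsOpenIntegral.addConst {p N : ℕ} {C : Finset (Fin p)} {Λ : Rates p N} {F : Fields p N}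
    (hF : IsOpenIntegral C Λ F) {c : Fin p → ℝ → CVec N} (hc : IsIntegrationConstant C c) :
    IsOpenIntegral C Λ (addConst F c) where
  real_rate := hF.real_rate
  real_field := fun j hj z hz t ht =>
    (stateSubmodule C N j).add_mem (hF.real_field j hj z hz t ht) (hc j t ht)
  jacobian := fun j z hz t ht => (hF.jacobian j z hz t ht).add_const _

theorem IsOpenIntegral.field_mem {p N : ℕ} {C : Finset (Fin p)} {Λ : Rates p N} {F : Fields p N}
    (hF : IsOpenIntegral C Λ F) (j : Fin p) {z : CVec N} (hz : z ∈ stateSpace C N j) {t : ℝ}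
    (ht : 0 ≤ t) : F j z t ∈ stateSpace C N j :=
  fun hj => hF.real_field j hj z hz t ht hj

theorem IsHierarchy.hasDerivWithinAt {p N : ℕ} {C : Finset (Fin p)} {F : Fields p N}
    {x : ℝ → RVec N} {z : Fin p → ℝ → CVec N} (h : IsHierarchy C F x z) (j : Fin p) {t : ℝ}
    (ht : 0 ≤ t) :
    HasDerivWithinAt (z j) (F j (z j t) t + nextRe (fun i => z i t) j) (Ici 0) t := by
  have := (h.diff j t ht).hasDerivWithinAt
  rwa [show derivWithin (z j) (Ici 0) t = F j (z j t) t + nextRe (fun i => z i t) j by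
    rw [← h.step j t ht, rateOp]; abel] at this

/-! ### Bounds for the rate of change of a distance -/

theorem hasDerivWithinAt_norm_sq {N : ℕ} {d : ℝ → CVec N} {d' : CVec N} {s : Set ℝ} {t : ℝ}
    (h : HasDerivWithinAt d d' s t) :
    HasDerivWithinAt (fun τ => ‖d τ‖ ^ 2) (2 * (inner ℂ (d t) d').re) s t := by
  have h1 := Complex.reCLM.hasFDerivAt.comp_hasDerivWithinAt t (h.inner ℂ h)
  have e : Complex.reCLM (inner ℂ (d t) d' + inner ℂ d' (d t)) = 2 * (inner ℂ (d t) d').re := by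
    rw [Complex.reCLM_apply, Complex.add_re, ← inner_conj_symm d', Complex.conj_re]; ring
  rw [e] at h1
  have e2 : (fun τ => ‖d τ‖ ^ 2) = Complex.reCLM ∘ fun τ => inner ℂ (d τ) (d τ) :=
    funext fun τ => (inner_self_eq_norm_sq (𝕜 := ℂ) (d τ)).symm
  rwa [e2]

theorem rateBounds_of_hasDerivWithinAt {N : ℕ} {d : ℝ → CVec N} {v w : CVec N} {lo hi t : ℝ}
    (h : HasDerivWithinAt d (v + w) (Ici 0) t) (hlo : lo * ‖d t‖ ^ 2 ≤ (inner ℂ (d t) v).re)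
    (hhi : (inner ℂ (d t) v).re ≤ hi * ‖d t‖ ^ 2) : RateBounds d w lo hi t := by
  refine ⟨_, hasDerivWithinAt_norm_sq h, ?_, ?_⟩ <;>
    rw [inner_add_right, Complex.add_re] <;> linarith

/-- Mean value theorem for an open integral along the segment joining two states. -/
theorem IsOpenIntegral.exists_re_inner_eq {p N : ℕ} {C : Finset (Fin p)} {Λ : Rates p N}
    {F : Fields p N} (hF : IsOpenIntegral C Λ F) (j : Fin p) {z w : CVec N}
    (hz : z ∈ stateSpace C N j) (hw : w ∈ stateSpace C N j) {t : ℝ} (ht : 0 ≤ t) :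
    ∃ ζ ∈ segment ℝ z w, (inner ℂ (z - w) (F j z t - F j w t)).re =
      (inner ℂ (z - w) (Matrix.toEuclideanCLM (n := Fin N) (𝕜 := ℂ) (Λ j ζ t) (z - w))).re := by
  set γ : ℝ → CVec N := fun s => w + s • (z - w) with hγ
  have hmem : ∀ s, γ s ∈ stateSpace C N j := fun s =>
    (stateSubmodule C N j).add_mem hw
      ((stateSubmodule C N j).smul_mem s ((stateSubmodule C N j).sub_mem hz hw))
  have hγd : ∀ s, HasDerivWithinAt γ (z - w) univ s := fun s => by
    have := ((hasDerivAt_id s).smul_const (z - w)).const_add w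
    rw [one_smul] at this
    exact this.hasDerivWithinAt
  -- Pairing with the fixed vector `z - w` makes the function real-valued. The mean value theorem
  -- then gives an equality at a single point, which fails for vector-valued functions.
  have hd : ∀ s, HasDerivAt (fun s => (inner ℂ (z - w) (F j (γ s) t)).re)
      (inner ℂ (z - w)
        (Matrix.toEuclideanCLM (n := Fin N) (𝕜 := ℂ) (Λ j (γ s) t) (z - w))).re s := fun s => by
    have h1 := (hF.jacobian j (γ s) (hmem s) t ht).comp_hasDerivWithinAt s (hγd s)
      (fun s _ => hmem s)
    have h2 := (Complex.reCLM.comp ((innerSL ℂ (z - w)).restrictScalars ℝ)).hasFDerivAt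
      |>.comp_hasDerivWithinAt s h1
    exact h2.hasDerivAt Filter.univ_mem
  obtain ⟨s, hs, h⟩ := exists_hasDerivAt_eq_slope _ _ zero_lt_one
    (fun s _ => (hd s).continuousAt.continuousWithinAt) (fun s _ => hd s)
  refine ⟨γ s, ?_, ?_⟩
  · rw [segment_symm, segment_eq_image']
    exact ⟨s, Ioo_subset_Icc_self hs, rfl⟩
  · have h1 : γ 1 = z := by simp [hγ]
    have h0 : γ 0 = w := by simp [hγ]
    rw [h, h1, h0, inner_sub_right, Complex.sub_re, sub_zero, div_one]

theorem RateBounds.mono {N : ℕ} {d : ℝ → CVec N} {w : CVec N} {lo hi lo' hi' t : ℝ}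
    (h : RateBounds d w lo hi t) (hlo : lo' ≤ lo) (hhi : hi ≤ hi') :
    RateBounds d w lo' hi' t := by
  obtain ⟨r, hr, h1, h2⟩ := h
  have hlo2 := mul_le_mul_of_nonneg_right hlo (sq_nonneg ‖d t‖)
  have hhi2 := mul_le_mul_of_nonneg_right hhi (sq_nonneg ‖d t‖)
  exact ⟨r, hr, by linarith, by linarith⟩

/-- A single mean value point serves both bounds. It depends on `t`, which is harmless because later
uses bound the eigenvalues on the whole segment. -/
theorem IsHierarchy.exists_rateBounds_sub {p N : ℕ} {C : Finset (Fin p)} {Λ : Rates p N}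
    {F : Fields p N} (hF : IsOpenIntegral C Λ F) {x y : ℝ → RVec N} {z w : Fin p → ℝ → CVec N}
    (hz : IsHierarchy C F x z) (hw : IsHierarchy C F y w) (j : Fin p) {t : ℝ} (ht : 0 ≤ t) :
    ∃ ζ ∈ segment ℝ (z j t) (w j t),
      RateBounds (fun τ => z j τ - w j τ) (nextRe (fun i => z i t - w i t) j)
        (lamMin (Λ j ζ t)) (lamMax (Λ j ζ t)) t := by
  obtain ⟨ζ, hζ, h⟩ := hF.exists_re_inner_eq j (hz.mem j t ht) (hw.mem j t ht) ht
  refine ⟨ζ, hζ, rateBounds_of_hasDerivWithinAt (v := F j (z j t) t - F j (w j t) t) ?_ ?_ ?_⟩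
  · rw [nextRe_sub, sub_add_sub_comm]
    exact (hz.hasDerivWithinAt j ht).sub (hw.hasDerivWithinAt j ht)
  · rw [h]
    exact lamMin_le_re_inner _ _
  · rw [h]
    exact re_inner_le_lamMax _ _

/-! ### Integrated bounds -/

/-- Freezing the value at `0` for negative times gives a globally continuous integrand, whose
primitive is differentiable also at `0`. -/
theorem exists_continuous_eqOn_Ici {L : ℝ → ℝ} (hL : ContinuousOn L (Ici 0)) :
    ∃ M : ℝ → ℝ, Continuous M ∧ ∀ t, 0 ≤ t → M t = L t :=
  ⟨fun t => L (max t 0),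
    hL.comp_continuous (continuous_id.max continuous_const) fun t => mem_Ici.2 (le_max_right t 0),
    fun t ht => by simp only [max_eq_left ht]⟩

theorem integral_congr_of_nonneg {f g : ℝ → ℝ} (h : ∀ t, 0 ≤ t → f t = g t) {a b : ℝ}
    (ha : 0 ≤ a) (hb : 0 ≤ b) : ∫ τ in a..b, f τ = ∫ τ in a..b, g τ :=
  intervalIntegral.integral_congr fun τ hτ => h τ ((le_min ha hb).trans hτ.1)

/-- A curve whose norm satisfies `‖u‖ (d/dt) ‖u‖ ≤ g ‖u‖` grows at most by the integral of `g`. -/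
theorem norm_le_add_integral_of_deriv_norm_sq_le {N : ℕ} {u : ℝ → CVec N} {r g : ℝ → ℝ}
    (hg : Continuous g) (hg0 : ∀ t, 0 ≤ t → 0 ≤ g t)
    (hr : ∀ t, 0 ≤ t → HasDerivWithinAt (fun τ => ‖u τ‖ ^ 2) (2 * r t) (Ici 0) t)
    (hle : ∀ t, 0 ≤ t → r t ≤ ‖u t‖ * g t) {t : ℝ} (ht : 0 ≤ t) :
    ‖u t‖ ≤ ‖u 0‖ + ∫ τ in (0 : ℝ)..t, g τ := by
  refine le_of_forall_pos_le_add fun ε hε => ?_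
  -- The norm need not be differentiable where `u` vanishes, so `√(‖u‖² + ε²)` replaces it. This
  -- costs at most `ε` at time `0`.
  have hpos : ∀ τ, 0 < ‖u τ‖ ^ 2 + ε ^ 2 := fun τ => by positivity
  have hle' : ∀ τ, ‖u τ‖ ≤ √(‖u τ‖ ^ 2 + ε ^ 2) := fun τ =>
    Real.le_sqrt_of_sq_le (by nlinarith)
  have hd : ∀ τ, 0 ≤ τ → HasDerivWithinAt
      (fun τ => √(‖u τ‖ ^ 2 + ε ^ 2) - ∫ σ in (0 : ℝ)..τ, g σ)
      (2 * r τ / (2 * √(‖u τ‖ ^ 2 + ε ^ 2)) - g τ) (Ici 0) τ := fun τ hτ =>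
    (((hr τ hτ).add_const _).sqrt (hpos τ).ne').sub
      (hg.integral_hasStrictDerivAt 0 τ).hasDerivAt.hasDerivWithinAt
  have hanti : AntitoneOn (fun τ => √(‖u τ‖ ^ 2 + ε ^ 2) - ∫ σ in (0 : ℝ)..τ, g σ) (Ici 0) := by
    refine antitoneOn_of_hasDerivWithinAt_nonpos (convex_Ici 0)
      (f' := fun τ => 2 * r τ / (2 * √(‖u τ‖ ^ 2 + ε ^ 2)) - g τ)
      (fun τ hτ => (hd τ hτ).continuousWithinAt)
      (fun τ hτ => (hd τ (interior_subset hτ)).mono interior_subset) fun τ hτ => ?_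
    have hτ0 : 0 ≤ τ := interior_subset hτ
    have hs : 0 < √(‖u τ‖ ^ 2 + ε ^ 2) := Real.sqrt_pos.2 (hpos τ)
    rw [sub_nonpos, mul_div_mul_left _ _ two_ne_zero, div_le_iff₀ hs, mul_comm (g τ)]
    exact (hle τ hτ0).trans (mul_le_mul_of_nonneg_right (hle' τ) (hg0 τ hτ0))
  have h := hanti (mem_Ici.2 le_rfl) ht ht
  simp only [intervalIntegral.integral_same, sub_zero] at h
  have h0 : √(‖u 0‖ ^ 2 + ε ^ 2) ≤ ‖u 0‖ + ε := by
    rw [Real.sqrt_le_iff]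
    constructor
    · positivity
    · nlinarith [mul_nonneg (norm_nonneg (u 0)) hε.le]
  linarith [hle' t]

/-- Gronwall's inequality for a curve whose distance from the origin has a rate bounded by `L`,
apart from a driving term `w`. -/
theorem norm_le_of_rateBounds {N : ℕ} {d w : ℝ → CVec N} {L : ℝ → ℝ}
    (hL : ContinuousOn L (Ici 0)) (hw : ContinuousOn w (Ici 0))
    (h : ∀ t, 0 ≤ t → ∃ lo, RateBounds d (w t) lo (L t) t) {t : ℝ} (ht : 0 ≤ t) :
    ‖d t‖ ≤ Real.exp (∫ τ in (0 : ℝ)..t, L τ) * ‖d 0‖ +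
      ∫ τ in (0 : ℝ)..t, Real.exp (∫ σ in τ..t, L σ) * ‖w τ‖ := by
  obtain ⟨M, hM, hML⟩ := exists_continuous_eqOn_Ici hL
  obtain ⟨W, hW, hWw⟩ := exists_continuous_eqOn_Ici hw.norm
  set P : ℝ → ℝ := fun t => ∫ τ in (0 : ℝ)..t, M τ with hP
  have hPd : ∀ t, HasDerivAt P (M t) t := fun t => (hM.integral_hasStrictDerivAt 0 t).hasDerivAt
  have hPc : Continuous P := continuous_iff_continuousAt.2 fun t => (hPd t).continuousAt
  choose! lo r hr _ hr2 using h
  -- The integrating factor `exp (-P)` removes the linear term: half the derivative of `‖u‖²` is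
  -- `exp (-P)² (r - M ‖d‖²)`, and Cauchy–Schwarz bounds this by `‖u‖` times `exp (-P) W`.
  set u : ℝ → CVec N := fun t => Real.exp (-P t) • d t with hu
  have hun : ∀ t, ‖u t‖ = Real.exp (-P t) * ‖d t‖ := fun t => by
    rw [hu, norm_smul, Real.norm_of_nonneg (Real.exp_pos _).le]
  have hsq : (fun τ => ‖u τ‖ ^ 2) = fun τ => Real.exp (-P τ) ^ 2 * ‖d τ‖ ^ 2 :=
    funext fun τ => by rw [hun, mul_pow]
  have hmain := norm_le_add_integral_of_deriv_norm_sq_le (u := u)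
    (r := fun τ => Real.exp (-P τ) ^ 2 * (r τ - M τ * ‖d τ‖ ^ 2))
    (g := fun τ => Real.exp (-P τ) * W τ) (by fun_prop)
    (fun τ hτ => mul_nonneg (Real.exp_pos _).le (by rw [hWw τ hτ]; positivity))
    (fun τ hτ => by
      rw [hsq]
      have h1 : HasDerivAt (fun τ => Real.exp (-P τ) ^ 2) (-2 * M τ * Real.exp (-P τ) ^ 2) τ :=
        ((hPd τ).fun_neg.exp.fun_pow 2).congr_deriv (by simp; ring)
      refine (h1.hasDerivWithinAt.mul (hr τ hτ)).congr_deriv ?_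
      ring)
    (fun τ hτ => by
      have h1 : (inner ℂ (d τ) (w τ)).re ≤ ‖d τ‖ * W τ := by
        rw [hWw τ hτ]; exact re_inner_le_norm (𝕜 := ℂ) _ _
      have h2 := hr2 τ hτ
      rw [← hML τ hτ] at h2
      rw [hun, sq, mul_assoc, mul_assoc]
      refine mul_le_mul_of_nonneg_left ?_ (Real.exp_pos _).le
      rw [mul_left_comm]
      exact mul_le_mul_of_nonneg_left (by linarith) (Real.exp_pos _).le) ht
  have hP0 : P 0 = 0 := by simp [hP]
  rw [hun, hun, hP0, neg_zero, Real.exp_zero, one_mul] at hmain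
  have hint : ∫ τ in (0 : ℝ)..t, Real.exp (∫ σ in τ..t, L σ) * ‖w τ‖ =
      Real.exp (P t) * ∫ τ in (0 : ℝ)..t, Real.exp (-P τ) * W τ := by
    rw [← intervalIntegral.integral_const_mul]
    refine intervalIntegral.integral_congr fun τ hτ => ?_
    have hτ0 : 0 ≤ τ := by simpa [ht] using hτ.1
    have : ∫ σ in τ..t, L σ = P t - P τ := by
      rw [hP, intervalIntegral.integral_interval_sub_left (hM.intervalIntegrable _ _)
        (hM.intervalIntegrable _ _)]
      exact integral_congr_of_nonneg (fun s hs => (hML s hs).symm) hτ0 ht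
    simp only [this, hWw τ hτ0, sub_eq_add_neg, Real.exp_add]
    ring
  have hL' : ∫ τ in (0 : ℝ)..t, L τ = P t :=
    integral_congr_of_nonneg (fun s hs => (hML s hs).symm) le_rfl ht
  rw [hint, hL', ← mul_add]
  calc ‖d t‖ = Real.exp (P t) * (Real.exp (-P t) * ‖d t‖) := by
        rw [← mul_assoc, ← Real.exp_add, add_neg_cancel, Real.exp_zero, one_mul]
    _ ≤ _ := mul_le_mul_of_nonneg_left hmain (Real.exp_pos _).le

/-! ### Cascades of bounds -/

/-- Downward induction on the levels. -/
theorem Fin.downward_induction {p : ℕ} {P : Fin p → Prop}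
    (h : ∀ j : Fin p, (∀ hj : (j : ℕ) + 1 < p, P ⟨(j : ℕ) + 1, hj⟩) → P j) (j : Fin p) : P j := by
  obtain ⟨k, hk⟩ : ∃ k, (j : ℕ) + k = p := ⟨p - j, by omega⟩
  induction k generalizing j with
  | zero => omega
  | succ k ih => exact h j fun hj => ih ⟨(j : ℕ) + 1, hj⟩ (by simp only; omega)

theorem Fin.Ici_eq_insert_of_lt {p : ℕ} (j : Fin p) (hj : (j : ℕ) + 1 < p) :
    Finset.Ici j = insert j (Finset.Ici (⟨(j : ℕ) + 1, hj⟩ : Fin p)) := by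
  ext i
  simp only [Finset.mem_Ici, Finset.mem_insert, Fin.le_def, Fin.ext_iff]
  omega

theorem Fin.Ici_eq_singleton {p : ℕ} (j : Fin p) (hj : ¬ (j : ℕ) + 1 < p) :
    Finset.Ici j = {j} := by
  ext i
  simp only [Finset.mem_Ici, Finset.mem_singleton, Fin.le_def, Fin.ext_iff]
  omega

theorem Fin.sum_Ici_of_lt {p : ℕ} (j : Fin p) (hj : (j : ℕ) + 1 < p) (f : Fin p → ℝ) :
    ∑ i ∈ Finset.Ici j, f i = f j + ∑ i ∈ Finset.Ici (⟨(j : ℕ) + 1, hj⟩ : Fin p), f i := by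
  rw [Fin.Ici_eq_insert_of_lt j hj, Finset.sum_insert]
  simp [Fin.le_def]

/-- Distances `D j` of a cascade, each of which is driven by the next one with the weight
`E t / E τ`, are bounded by a polynomial multiple of `E`. -/
theorem cascade_bound {p : ℕ} {D w : Fin p → ℝ → ℝ} {L : ℝ → ℝ} (hL : ContinuousOn L (Ici 0))
    (hw : ∀ j, ContinuousOn (w j) (Ici 0))
    (hwD : ∀ (j : Fin p) (hj : (j : ℕ) + 1 < p) t, 0 ≤ t → w j t ≤ D ⟨(j : ℕ) + 1, hj⟩ t)
    (hw0 : ∀ j : Fin p, ¬ (j : ℕ) + 1 < p → ∀ t, 0 ≤ t → w j t = 0)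
    (h : ∀ j t, 0 ≤ t → D j t ≤ Real.exp (∫ τ in (0 : ℝ)..t, L τ) * D j 0 +
      ∫ τ in (0 : ℝ)..t, Real.exp (∫ σ in τ..t, L σ) * w j τ) (j : Fin p) :
    ∀ t, 0 ≤ t → D j t ≤ Real.exp (∫ τ in (0 : ℝ)..t, L τ) *
      ∑ i ∈ Finset.Ici j, t ^ ((i : ℕ) - j) / (Nat.factorial ((i : ℕ) - j)) * D i 0 := by
  obtain ⟨M, hM, hML⟩ := exists_continuous_eqOn_Ici hL
  set P : ℝ → ℝ := fun t => ∫ τ in (0 : ℝ)..t, M τ with hP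
  have hPc : Continuous P := continuous_iff_continuousAt.2 fun t =>
    (hM.integral_hasStrictDerivAt 0 t).hasDerivAt.continuousAt
  have hLP : ∀ a t, 0 ≤ a → 0 ≤ t → ∫ τ in a..t, L τ = P t - P a := fun a t ha ht => by
    rw [hP, intervalIntegral.integral_interval_sub_left (hM.intervalIntegrable _ _)
      (hM.intervalIntegrable _ _)]
    exact integral_congr_of_nonneg (fun s hs => (hML s hs).symm) ha ht
  induction j using Fin.downward_induction with
  | h j ih =>
  intro t ht
  by_cases hj : (j : ℕ) + 1 < p
  · refine (h j t ht).trans ?_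
    set S : ℝ → ℝ := fun τ => ∑ i ∈ Finset.Ici (⟨(j : ℕ) + 1, hj⟩ : Fin p),
      τ ^ ((i : ℕ) - (j + 1)) / (Nat.factorial ((i : ℕ) - (j + 1))) * D i 0 with hS
    -- Inserting the bound of the next level, the weights `exp (P t - P τ)` and `exp (P τ)` combine
    -- to `exp (P t)`, so only the polynomial `S` is left to integrate.
    have hSc : Continuous S := by fun_prop
    have h1 : ∫ τ in (0 : ℝ)..t, Real.exp (∫ σ in τ..t, L σ) * w j τ ≤
        ∫ τ in (0 : ℝ)..t, Real.exp (∫ σ in (0 : ℝ)..t, L σ) * S τ := by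
      have hcongr : ∀ τ ∈ Icc (0 : ℝ) t, Real.exp (∫ σ in τ..t, L σ) * w j τ =
          Real.exp (P t - P τ) * w j τ := fun τ hτ => by rw [hLP τ t hτ.1 ht]
      refine intervalIntegral.integral_mono_on ht ?_ ?_ fun τ hτ => ?_
      · refine ContinuousOn.intervalIntegrable ?_
        rw [uIcc_of_le ht]
        exact (((by fun_prop : Continuous fun τ => Real.exp (P t - P τ)).continuousOn).mul
          ((hw j).mono Icc_subset_Ici_self)).congr hcongr
      · exact (continuous_const.mul hSc).intervalIntegrable _ _
      · rw [hLP τ t hτ.1 ht, hLP 0 t le_rfl ht]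
        have h2 := (hwD j hj τ hτ.1).trans (ih hj τ hτ.1)
        rw [hLP 0 τ le_rfl hτ.1] at h2
        refine (mul_le_mul_of_nonneg_left h2 (Real.exp_pos _).le).trans_eq ?_
        rw [← mul_assoc, ← Real.exp_add]
        congr 2
        ring
    -- Each integration turns `τ ^ k / k!` into `t ^ (k + 1) / (k + 1)!`. The truncated subtractions
    -- are genuine since `i ≥ j + 1`.
    have h2 : ∫ τ in (0 : ℝ)..t, S τ = ∑ i ∈ Finset.Ici (⟨(j : ℕ) + 1, hj⟩ : Fin p),
        t ^ ((i : ℕ) - j) / (Nat.factorial ((i : ℕ) - j)) * D i 0 := by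
      rw [hS, intervalIntegral.integral_finsetSum fun i _ =>
        (by fun_prop : Continuous _).intervalIntegrable _ _]
      refine Finset.sum_congr rfl fun i hi => ?_
      rw [intervalIntegral.integral_mul_const, intervalIntegral.integral_div, integral_pow]
      have hij : (j : ℕ) + 1 ≤ i := Fin.le_def.1 (Finset.mem_Ici.1 hi)
      obtain ⟨k, hk⟩ := Nat.exists_eq_add_of_le hij
      rw [hk, show (j : ℕ) + 1 + k - (j + 1) = k by omega,
        show (j : ℕ) + 1 + k - j = k + 1 by omega, Nat.factorial_succ]
      push_cast
      rw [zero_pow (Nat.succ_ne_zero k), sub_zero, div_div]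
    rw [Fin.sum_Ici_of_lt j hj, mul_add]
    refine add_le_add (by simp) (h1.trans_eq ?_)
    rw [intervalIntegral.integral_const_mul, h2]
  · refine (h j t ht).trans_eq ?_
    rw [Fin.Ici_eq_singleton j hj, Finset.sum_singleton,
      integral_congr_of_nonneg (f := fun τ => _ * w j τ) (g := fun _ => 0) (fun τ hτ => by rw [hw0 j hj τ hτ, mul_zero])
        le_rfl ht]
    simp

/-- Convolving `exp (-α t)` with `exp (-β t)` gives at most `exp (-β t) / (α - β)`. Giving up the
gap `α - β` in the rate thus replaces the powers of `t` by one constant factor per level. -/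
theorem exponential_cascade_bound {p : ℕ} {D w : Fin p → ℝ → ℝ} {α β : ℝ} (hβ : β < α)
    (hD : ∀ j, 0 ≤ D j 0)
    (hw : ∀ j, ContinuousOn (w j) (Ici 0))
    (hwD : ∀ (j : Fin p) (hj : (j : ℕ) + 1 < p) t, 0 ≤ t → w j t ≤ D ⟨(j : ℕ) + 1, hj⟩ t)
    (hw0 : ∀ j : Fin p, ¬ (j : ℕ) + 1 < p → ∀ t, 0 ≤ t → w j t = 0)
    (h : ∀ j t, 0 ≤ t → D j t ≤ Real.exp (∫ _ in (0 : ℝ)..t, -α) * D j 0 +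
      ∫ τ in (0 : ℝ)..t, Real.exp (∫ _ in τ..t, -α) * w j τ) (j : Fin p) :
    ∀ t, 0 ≤ t → D j t ≤ Real.exp (-β * t) *
      ∑ i ∈ Finset.Ici j, ((α - β)⁻¹) ^ ((i : ℕ) - j) * D i 0 := by
  simp only [intervalIntegral.integral_const, smul_eq_mul, sub_zero] at h
  have hαβ : 0 < α - β := sub_pos.2 hβ
  have hexp : ∀ t, 0 ≤ t → Real.exp (t * -α) ≤ Real.exp (-β * t) := fun t ht =>
    Real.exp_le_exp.2 (by nlinarith)
  induction j using Fin.downward_induction with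
  | h j ih =>
  intro t ht
  by_cases hj : (j : ℕ) + 1 < p
  · refine (h j t ht).trans ?_
    set S : ℝ := ∑ i ∈ Finset.Ici (⟨(j : ℕ) + 1, hj⟩ : Fin p),
      ((α - β)⁻¹) ^ ((i : ℕ) - (j + 1)) * D i 0 with hS
    have hS0 : 0 ≤ S := Finset.sum_nonneg fun i _ =>
      mul_nonneg (pow_nonneg (inv_nonneg.2 hαβ.le) _) (hD i)
    have h1 : ∫ τ in (0 : ℝ)..t, Real.exp ((t - τ) * -α) * w j τ ≤
        ∫ τ in (0 : ℝ)..t, Real.exp (t * -α) * S * Real.exp ((α - β) * τ) := by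
      refine intervalIntegral.integral_mono_on ht ?_ ?_ fun τ hτ => ?_
      · refine ContinuousOn.intervalIntegrable ?_
        rw [uIcc_of_le ht]
        exact ((by fun_prop : Continuous fun τ => Real.exp ((t - τ) * -α)).continuousOn).mul
          ((hw j).mono Icc_subset_Ici_self)
      · exact (by fun_prop : Continuous _).intervalIntegrable _ _
      · have h2 := (hwD j hj τ hτ.1).trans (ih hj τ hτ.1)
        refine (mul_le_mul_of_nonneg_left h2 (Real.exp_pos _).le).trans_eq ?_
        rw [← mul_assoc, ← Real.exp_add, mul_right_comm, ← Real.exp_add]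
        congr 2
        ring
    have h2 : ∫ τ in (0 : ℝ)..t, Real.exp ((α - β) * τ) =
        (α - β)⁻¹ * (Real.exp ((α - β) * t) - 1) := by
      rw [intervalIntegral.integral_comp_mul_left _ hαβ.ne', integral_exp, mul_zero,
        Real.exp_zero, smul_eq_mul]
    rw [intervalIntegral.integral_const_mul, h2] at h1
    have h3 : ∑ i ∈ Finset.Ici (⟨(j : ℕ) + 1, hj⟩ : Fin p), ((α - β)⁻¹) ^ ((i : ℕ) - j) * D i 0 =
        (α - β)⁻¹ * S := by
      rw [hS, Finset.mul_sum]
      refine Finset.sum_congr rfl fun i hi => ?_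
      have hij : (j : ℕ) + 1 ≤ i := Fin.le_def.1 (Finset.mem_Ici.1 hi)
      rw [show (i : ℕ) - j = (i - (j + 1)) + 1 by omega, pow_succ]
      ring
    rw [Fin.sum_Ici_of_lt j hj, mul_add, h3]
    refine add_le_add ?_ (h1.trans ?_)
    · simpa using mul_le_mul_of_nonneg_right (hexp t ht) (hD j)
    · have h4 : Real.exp (t * -α) * Real.exp ((α - β) * t) = Real.exp (-β * t) := by
        rw [← Real.exp_add]; congr 1; ring
      -- The `-1` from the lower end of the integral is dropped, which needs this sign and hence the
      -- nonnegative initial distances.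
      have h5 : 0 ≤ (α - β)⁻¹ * S := mul_nonneg (inv_nonneg.2 hαβ.le) hS0
      rw [← h4]
      nlinarith [mul_nonneg (Real.exp_pos (t * -α)).le h5]
  · refine (h j t ht).trans ?_
    rw [Fin.Ici_eq_singleton j hj, Finset.sum_singleton,
      integral_congr_of_nonneg (f := fun τ => _ * w j τ) (g := fun _ => 0) (fun τ hτ => by rw [hw0 j hj τ hτ, mul_zero])
        le_rfl ht]
    simpa using mul_le_mul_of_nonneg_right (hexp t ht) (hD j)

/-! ### Virtual displacements -/

/-- A `C²` function on the half-plane has partial derivatives `g`, `k` and one common mixed second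
derivative `m`. -/
theorem exists_partialDerivs_and_mixedDeriv {E : Type*} [NormedAddCommGroup E] [NormedSpace ℝ E]
    {f : ℝ × ℝ → E} (hf : ContDiffOn ℝ 2 f (univ ×ˢ Ici 0)) :
    ∃ g k m : ℝ → ℝ → E, ∀ s t, 0 ≤ t →
      HasDerivAt (fun σ => f (σ, t)) (g s t) s ∧
      HasDerivWithinAt (fun τ => f (s, τ)) (k s t) (Ici 0) t ∧
      HasDerivAt (fun σ => k σ t) (m s t) s ∧
      HasDerivWithinAt (fun τ => g s τ) (m s t) (Ici 0) t := by
  set S : Set (ℝ × ℝ) := univ ×ˢ Ici 0 with hS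
  have hu : UniqueDiffOn ℝ S := uniqueDiffOn_univ.prod (uniqueDiffOn_Ici 0)
  have hf' : ContDiffOn ℝ 1 (fderivWithin ℝ f S) S := hf.fderivWithin hu (by norm_num)
  have hfst : ∀ s t : ℝ, HasDerivWithinAt (fun σ : ℝ => (σ, t)) (1, 0) univ s := fun s t =>
    ((hasDerivAt_id s).prodMk (hasDerivAt_const s t)).hasDerivWithinAt
  have hsnd : ∀ s t : ℝ, HasDerivWithinAt (fun τ : ℝ => (s, τ)) (0, 1) (Ici 0) t := fun s t =>
    ((hasDerivAt_const t s).prodMk (hasDerivAt_id t)).hasDerivWithinAt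
  refine ⟨fun s t => fderivWithin ℝ f S (s, t) (1, 0), fun s t => fderivWithin ℝ f S (s, t) (0, 1),
    fun s t => fderivWithin ℝ (fderivWithin ℝ f S) S (s, t) (1, 0) (0, 1), fun s t ht => ?_⟩
  have hmem : (s, t) ∈ S := ⟨mem_univ _, ht⟩
  have hm1 : MapsTo (fun σ : ℝ => (σ, t)) univ S := fun σ _ => ⟨mem_univ _, ht⟩
  have hm2 : MapsTo (fun τ : ℝ => (s, τ)) (Ici 0) S := fun τ hτ => ⟨mem_univ _, hτ⟩
  have h1 : HasFDerivWithinAt f (fderivWithin ℝ f S (s, t)) S (s, t) :=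
    ((hf.differentiableOn (by norm_num)) _ hmem).hasFDerivWithinAt
  have h2 : HasFDerivWithinAt (fderivWithin ℝ f S)
      (fderivWithin ℝ (fderivWithin ℝ f S) S (s, t)) S (s, t) :=
    ((hf'.differentiableOn (by norm_num)) _ hmem).hasFDerivWithinAt
  -- Symmetry also holds on the boundary `t = 0`, because the closed half-plane is the closure of
  -- its interior.
  have hsymm : IsSymmSndFDerivWithinAt ℝ f S (s, t) := by
    refine (hf _ hmem).isSymmSndFDerivWithinAt (by simp) hu ?_ hmem
    rw [hS, interior_prod_eq, interior_univ, interior_Ici, closure_prod_eq, closure_univ,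
      closure_Ioi]
    exact hmem
  refine ⟨?_, ?_, ?_, ?_⟩
  · exact (h1.comp_hasDerivWithinAt s (hfst s t) hm1).hasDerivAt Filter.univ_mem
  · exact h1.comp_hasDerivWithinAt t (hsnd s t) hm2
  · exact ((ContinuousLinearMap.apply ℝ E ((0 : ℝ), (1 : ℝ))).hasFDerivAt.comp_hasDerivWithinAt s
      (h2.comp_hasDerivWithinAt s (hfst s t) hm1)).hasDerivAt Filter.univ_mem
  · have h3 := (ContinuousLinearMap.apply ℝ E ((1 : ℝ), (0 : ℝ))).hasFDerivAt.comp_hasDerivWithinAt t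
      (h2.comp_hasDerivWithinAt t (hsnd s t) hm2)
    refine h3.congr_deriv ?_
    exact hsymm _ _

theorem hasDerivAt_nextRe {p N : ℕ} {z : Fin p → ℝ → CVec N} {z' : Fin p → CVec N} {s : ℝ}
    (hz : ∀ i, HasDerivAt (z i) (z' i) s) (j : Fin p) :
    HasDerivAt (fun σ => nextRe (fun i => z i σ) j) (nextRe z' j) s := by
  by_cases h : (j : ℕ) + 1 < p
  · simp only [nextRe_of_lt _ _ h]
    exact (realProj N).hasFDerivAt.comp_hasDerivAt s (hz _)
  · simp only [nextRe_of_not_lt _ _ h]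
    exact hasDerivAt_const _ _

/-- At fixed `t` the evolution equation is an identity in the family parameter. Differentiating it
there needs only the Jacobian of `F_j` in the state, no regularity in time. The `C²` assumption then
identifies the result with the time derivative of the displacement. -/
theorem hasDerivWithinAt_virtualDisp {p N : ℕ} {C : Finset (Fin p)} {Λ : Rates p N}
    {F : Fields p N} (hF : IsOpenIntegral C Λ F) {ξ : ℝ → ℝ → RVec N}
    {Z : ℝ → Fin p → ℝ → CVec N} (hZ : ∀ s, IsHierarchy C F (ξ s) (Z s))
    (hC2 : ∀ j, ContDiffOn ℝ 2 (fun q : ℝ × ℝ => Z q.1 j q.2) (univ ×ˢ Ici 0))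
    (s : ℝ) (j : Fin p) {t : ℝ} (ht : 0 ≤ t) :
    HasDerivWithinAt (virtualDisp Z s j)
      (Matrix.toEuclideanCLM (n := Fin N) (𝕜 := ℂ) (Λ j (Z s j t) t) (virtualDisp Z s j t)
        + nextRe (fun i => virtualDisp Z s i t) j) (Ici 0) t := by
  choose g k m hg hk hm hmg using fun j => exists_partialDerivs_and_mixedDeriv (hC2 j)
  have hgv : ∀ i s t, 0 ≤ t → virtualDisp Z s i t = g i s t := fun i s t ht =>
    (hg i s t ht).deriv
  have hkeq : ∀ σ, k j σ t = F j (Z σ j t) t + nextRe (fun i => Z σ i t) j := fun σ =>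
    (uniqueDiffOn_Ici (0 : ℝ) t ht).eq_deriv _ (hk j σ t ht) ((hZ σ).hasDerivWithinAt j ht)
  have h1 : HasDerivAt (fun σ => F j (Z σ j t) t)
      (Matrix.toEuclideanCLM (n := Fin N) (𝕜 := ℂ) (Λ j (Z s j t) t) (g j s t)) s :=
    (HasFDerivWithinAt.comp_hasDerivWithinAt (f := fun σ => Z σ j t) (s := univ) s
      (hF.jacobian j _ ((hZ s).mem j t ht) t ht) (hg j s t ht).hasDerivWithinAt
      fun σ _ => (hZ σ).mem j t ht).hasDerivAt Filter.univ_mem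
  have h2 := h1.add (hasDerivAt_nextRe (fun i => hg i s t ht) j)
  have h3 : m j s t = _ := (hm j s t ht).unique (h2.congr_of_eventuallyEq (.of_forall hkeq))
  simp only [hgv _ s t ht]
  rw [← h3]
  exact (hmg j s t ht).congr (fun τ hτ => hgv j s τ hτ) (hgv j s t ht)

/-! ### Global contraction -/

theorem IsHierarchy.continuousOn_nextRe_sub {p N : ℕ} {C : Finset (Fin p)} {F : Fields p N}
    {x y : ℝ → RVec N} {z w : Fin p → ℝ → CVec N}
    (hz : IsHierarchy C F x z) (hw : IsHierarchy C F y w) (j : Fin p) :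
    ContinuousOn (fun t => nextRe (fun i => z i t - w i t) j) (Ici 0) :=
  continuousOn_nextRe (z := fun i t => z i t - w i t)
    (fun i => (hz.diff i).continuousOn.sub (hw.diff i).continuousOn) j

theorem IsHierarchy.norm_sub_le {p N : ℕ} {C : Finset (Fin p)} {Λ : Rates p N}
    {F : Fields p N} (hF : IsOpenIntegral C Λ F) {x y : ℝ → RVec N} {z w : Fin p → ℝ → CVec N}
    (hz : IsHierarchy C F x z) (hw : IsHierarchy C F y w) (j : Fin p) {L : ℝ → ℝ}
    (hL : ContinuousOn L (Ici 0))
    (hle : ∀ t, 0 ≤ t → ∀ ζ ∈ segment ℝ (z j t) (w j t), lamMax (Λ j ζ t) ≤ L t)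
    {t : ℝ} (ht : 0 ≤ t) :
    ‖z j t - w j t‖ ≤ Real.exp (∫ τ in (0 : ℝ)..t, L τ) * ‖z j 0 - w j 0‖ +
      ∫ τ in (0 : ℝ)..t, Real.exp (∫ σ in τ..t, L σ) * ‖nextRe (fun i => z i τ - w i τ) j‖ :=
  norm_le_of_rateBounds (d := fun τ => z j τ - w j τ) hL (hz.continuousOn_nextRe_sub hw j)
    (fun τ hτ => by
      obtain ⟨ζ, hζ, h⟩ := hz.exists_rateBounds_sub hF hw j hτ
      exact ⟨_, h.mono le_rfl (hle τ hτ ζ hζ)⟩) ht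

theorem IsHierarchy.norm_sub_first_le {p N : ℕ} {C : Finset (Fin p)} {F : Fields p N}
    {x y : ℝ → RVec N} {z w : Fin p → ℝ → CVec N}
    (hz : IsHierarchy C F x z) (hw : IsHierarchy C F y w) (hp : 0 < p) {t : ℝ} (ht : 0 ≤ t) :
    ‖x t - y t‖ ≤ ‖z ⟨0, hp⟩ t - w ⟨0, hp⟩ t‖ := by
  rw [← hz.first ⟨0, hp⟩ rfl t ht, ← hw.first ⟨0, hp⟩ rfl t ht, ← rePart_sub]
  exact norm_rePart_le _

theorem Fin.sum_Ici_zero {p : ℕ} (hp : 0 < p) (f : Fin p → ℝ) :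
    ∑ i ∈ Finset.Ici ⟨0, hp⟩, f i = ∑ i, f i := by
  congr 1
  ext i
  simp [Fin.le_def]

/-- Stated for an arbitrary set of motions, so that it covers both the closed loop alone and the
closed loop with a desired trajectory adjoined. -/
theorem globalContraction_of_characteristicEq {p N : ℕ} {C : Finset (Fin p)} {Λ : Rates p N}
    {F : Fields p N} (hF : IsOpenIntegral C Λ F) (hp : 0 < p) {X : Set (ℝ → RVec N)}
    (hX : ∀ x ∈ X, CharacteristicEq C F x) :
    GlobalContraction C Λ X (IsHierarchy C F) where
  coords := hX
  virtual := fun ξ Z hZ hC2 s j t ht => by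
    have h := hasDerivWithinAt_virtualDisp hF (fun s => (hZ s).2) hC2 s j ht
    exact ⟨h, rateBounds_of_hasDerivWithinAt h (lamMin_le_re_inner _ _) (re_inner_le_lamMax _ _)⟩
  finite := fun x _ y _ z w hz hw j t ht lo hi h =>
    let ⟨ζ, hζ, hr⟩ := hz.exists_rateBounds_sub hF hw j ht
    hr.mono (h ζ hζ).1 (h ζ hζ).2
  level := fun x _ y _ z w hz hw j L hL h t ht => hz.norm_sub_le hF hw j hL h ht
  cascade := fun x _ y _ z w hz hw L hL h t ht => by
    have hb := cascade_bound (D := fun j t => ‖z j t - w j t‖) hL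
      (fun j => (hz.continuousOn_nextRe_sub hw j).norm)
      (fun j hj t _ => norm_nextRe_le (fun i => z i t - w i t) j hj)
      (fun j hj t _ => by rw [nextRe_of_not_lt _ _ hj, norm_zero])
      (fun j t ht => hz.norm_sub_le hF hw j hL (h j) ht)
    refine ⟨fun j => hb j t ht, ?_⟩
    simpa [Fin.sum_Ici_zero] using (hz.norm_sub_first_le hw hp ht).trans (hb ⟨0, hp⟩ t ht)
  exponential := fun α h β hβ x _ y _ z w hz hw t ht => by
    have hb := exponential_cascade_bound (D := fun j t => ‖z j t - w j t‖) hβ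
      (fun j => norm_nonneg _)
      (fun j => (hz.continuousOn_nextRe_sub hw j).norm)
      (fun j hj t _ => norm_nextRe_le (fun i => z i t - w i t) j hj)
      (fun j hj t _ => by rw [nextRe_of_not_lt _ _ hj, norm_zero])
      (fun j t ht => hz.norm_sub_le hF hw j continuousOn_const
        -- State spaces are convex, so the uniform eigenvalue bound holds along every connecting
        -- segment.
        (fun t ht ζ hζ => h j ζ ((stateSubmodule C N j).convex.segment_subset
          (hz.mem j t ht) (hw.mem j t ht) hζ) t ht) ht)
    refine ⟨fun j => hb j t ht, ?_⟩
    simpa [Fin.sum_Ici_zero] using (hz.norm_sub_first_le hw hp ht).trans (hb ⟨0, hp⟩ t ht)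

/-! ### Tracking -/

/-- The integration constants for which given states form a hierarchy. -/
noncomputable def trackingConst {p N : ℕ} (F : Fields p N) (z : Fin p → ℝ → CVec N) :
    Fin p → ℝ → CVec N :=
  fun j t => rateOp F j (z j) t - nextRe (fun i => z i t) j

theorem isIntegrationConstant_trackingConst {p N : ℕ} {C : Finset (Fin p)} {Λ : Rates p N}
    {F : Fields p N} (hF : IsOpenIntegral C Λ F) {z : Fin p → ℝ → CVec N}
    (hmem : ∀ j t, 0 ≤ t → z j t ∈ stateSpace C N j)
    (hz : ∀ j, DifferentiableOn ℝ (z j) (Ici 0)) :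
    IsIntegrationConstant C (trackingConst F z) := fun j t ht =>
  (stateSubmodule C N j).sub_mem
    ((stateSubmodule C N j).sub_mem (derivWithin_mem_stateSpace C j (hmem j) (hz j) t ht)
      (hF.field_mem j (hmem j t ht) ht))
    (nextRe_mem_stateSpace C _ j j)

theorem isHierarchy_of_eq_trackingConst {p N : ℕ} {C : Finset (Fin p)} {F : Fields p N}
    {x : ℝ → RVec N} {z : Fin p → ℝ → CVec N} {c : Fin p → ℝ → CVec N}
    (hfirst : ∀ j : Fin p, (j : ℕ) = 0 → ∀ t, 0 ≤ t → rePart (z j t) = x t)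
    (hmem : ∀ j t, 0 ≤ t → z j t ∈ stateSpace C N j)
    (hz : ∀ j, DifferentiableOn ℝ (z j) (Ici 0))
    (hc : ∀ j t, 0 ≤ t → c j t = trackingConst F z j t) :
    IsHierarchy C (addConst F c) x z where
  first := hfirst
  mem := hmem
  diff := hz
  step := fun j t ht => by
    simp only [rateOp, addConst, hc j t ht, trackingConst]
    abel

theorem SmoothFields.contDiffOn_rateOp {p N : ℕ} {C : Finset (Fin p)} {F : Fields p N}
    (hF : SmoothFields C F) (j : Fin p) {z : ℝ → CVec N}
    (hmem : ∀ t, 0 ≤ t → z t ∈ stateSpace C N j) (hz : ContDiffOn ℝ ∞ z (Ici 0)) :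
    ContDiffOn ℝ ∞ (rateOp F j z) (Ici 0) :=
  (hz.derivWithin (uniqueDiffOn_Ici 0) (by simp)).sub
    ((hF j).comp (hz.prodMk contDiffOn_id) fun t ht => ⟨hmem t ht, ht⟩)

theorem contDiffOn_toCVec {N : ℕ} {x : ℝ → RVec N} (hx : ContDiffOn ℝ ∞ x (Ici 0)) :
    ContDiffOn ℝ ∞ (fun t => toCVec (x t)) (Ici 0) :=
  (toCVecCLM N).contDiff.comp_contDiffOn hx

theorem contDiffOn_nextRe {p N : ℕ} {z : Fin p → ℝ → CVec N}
    (hz : ∀ i, ContDiffOn ℝ ∞ (z i) (Ici 0)) (j : Fin p) :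
    ContDiffOn ℝ ∞ (fun t => nextRe (fun i => z i t) j) (Ici 0) := by
  by_cases h : (j : ℕ) + 1 < p
  · simp only [nextRe_of_lt _ _ h]
    exact (realProj N).contDiff.comp_contDiffOn (hz _)
  · simp only [nextRe_of_not_lt _ _ h]
    exact contDiffOn_const

theorem toCVec_rePart_of_mem {p N : ℕ} {C : Finset (Fin p)} {j : Fin p} (hj : j ∉ C)
    {z : CVec N} (hz : z ∈ stateSpace C N j) : toCVec (rePart z) = z := by
  ext i
  apply Complex.ext <;> simp [toCVec, rePart, hz hj i]

/-- The states of a trajectory that is followed without integration constants except at the last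
level: `z_1 = x` and `z_{j+1} = (d/dt - ∫ Λ_j d) z_j`. -/
noncomputable def realStates {p N : ℕ} (F : Fields p N) (x : ℝ → RVec N) : ℕ → ℝ → CVec N
  | 0 => fun t => toCVec (x t)
  -- The value `0` beyond the last level is a mere default: hierarchies use only indices below `p`.
  | k + 1 => if h : k < p then rateOp F ⟨k, h⟩ (realStates F x k) else 0

/-- Each level consumes one time derivative and one composition with `F`, so infinite smoothness of
both `x` and `F` lets the recursion continue. -/
theorem realStates_real_and_smooth {p N : ℕ} {Λ : Rates p N} {F : Fields p N}
    (hF : IsOpenIntegral ∅ Λ F) (hs : SmoothFields ∅ F) {x : ℝ → RVec N}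
    (hx : ContDiffOn ℝ ∞ x (Ici 0)) (k : ℕ) :
    (∀ j : Fin p, ∀ t, 0 ≤ t → realStates F x k t ∈ stateSpace ∅ N j) ∧
      ContDiffOn ℝ ∞ (realStates F x k) (Ici 0) := by
  induction k with
  | zero => exact ⟨fun j t _ => toCVec_mem_stateSpace ∅ j (x t), contDiffOn_toCVec hx⟩
  | succ k ih =>
    rw [realStates]
    split
    · rename_i h
      refine ⟨fun j t ht _ => ?_, hs.contDiffOn_rateOp _ (ih.1 _) ih.2⟩
      exact (stateSubmodule ∅ N ⟨k, h⟩).sub_mem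
        (derivWithin_mem_stateSpace ∅ ⟨k, h⟩ (ih.1 _) (ih.2.differentiableOn (by simp)) t ht)
        (hF.field_mem ⟨k, h⟩ (ih.1 _ t ht) ht) (Finset.notMem_empty _)
    · exact ⟨fun j t _ => (stateSubmodule ∅ N j).zero_mem, contDiffOn_const⟩

/-- With real rates, `Re` acts as the identity on every state, so the next state reproduces the
residual exactly and nothing is left for the constant to absorb. -/
theorem trackingConst_realStates {p N : ℕ} {Λ : Rates p N} {F : Fields p N}
    (hF : IsOpenIntegral ∅ Λ F) (hs : SmoothFields ∅ F) {x : ℝ → RVec N}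
    (hx : ContDiffOn ℝ ∞ x (Ici 0)) (j : Fin p) (hj : (j : ℕ) + 1 < p) {t : ℝ} (ht : 0 ≤ t) :
    trackingConst F (fun i => realStates F x i) j t = 0 := by
  have hm := (realStates_real_and_smooth hF hs hx ((j : ℕ) + 1)).1 ⟨(j : ℕ) + 1, hj⟩ t ht
  rw [trackingConst, nextRe_of_lt _ _ hj, realProj_apply,
    toCVec_rePart_of_mem (Finset.notMem_empty _) hm, sub_eq_zero]
  simp only [realStates, j.isLt, dif_pos, Fin.eta]

theorem exists_integrationConstant_tracking {p N : ℕ} {C : Finset (Fin p)} {Λ : Rates p N}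
    {F : Fields p N} (hF : IsOpenIntegral C Λ F) {x : ℝ → RVec N}
    (hx : ContDiffOn ℝ ∞ x (Ici 0)) :
    ∃ c, IsIntegrationConstant C c ∧
      (SmoothFields C F → (∀ j, ContDiffOn ℝ ∞ (c j) (Ici 0)) ∧
        (C = ∅ → ∀ j : Fin p, (j : ℕ) + 1 < p → c j = 0)) ∧
      CharacteristicEq C (addConst F c) x := by
  -- One choice of `c` must meet all clauses, so the sparse construction is used exactly when its
  -- conclusion is demanded. Otherwise `z_1` is the trajectory, all other states are zero and the
  -- constants absorb every residual, which takes only one derivative.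
  by_cases hC : C = ∅ ∧ SmoothFields C F
  · obtain ⟨rfl, hs⟩ := hC
    have hr := realStates_real_and_smooth hF hs hx
    set z : Fin p → ℝ → CVec N := fun i => realStates F x i with hz
    have hmem : ∀ j t, 0 ≤ t → z j t ∈ stateSpace ∅ N j := fun j => (hr j).1 j
    have hd : ∀ j, DifferentiableOn ℝ (z j) (Ici 0) := fun j =>
      (hr j).2.differentiableOn (by simp)
    -- The vanishing of `c j` is required as a function on all of `ℝ`, while `trackingConst` is
    -- known to vanish only for `t ≥ 0`. Hence the explicit zero branch.
    have hc : ∀ j t, 0 ≤ t → (fun j : Fin p => if (j : ℕ) + 1 < p then 0 else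
        trackingConst F z j) j t = trackingConst F z j t := fun j t ht => by
      by_cases hj : (j : ℕ) + 1 < p
      · simp [hj, hz, trackingConst_realStates hF hs hx j hj ht]
      · simp [hj]
    refine ⟨fun j => if (j : ℕ) + 1 < p then 0 else trackingConst F z j, fun j t ht => ?_,
      fun _ => ⟨fun j => ?_, fun _ j hj => if_pos hj⟩, z, isHierarchy_of_eq_trackingConst
        (fun j hj t _ => ?_) hmem hd hc⟩
    · rw [hc j t ht]
      exact isIntegrationConstant_trackingConst hF hmem hd j t ht
    · exact ((hs.contDiffOn_rateOp j (hmem j) (hr j).2).sub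
        (contDiffOn_nextRe (fun i => (hr i).2) j)).congr fun t ht => hc j t ht
    · simp only [hz, hj, realStates, rePart_toCVec]
  · set z : Fin p → ℝ → CVec N := fun j t => if (j : ℕ) = 0 then toCVec (x t) else 0 with hz
    have hmem : ∀ j t, 0 ≤ t → z j t ∈ stateSpace C N j := fun j t _ => by
      simp only [hz]
      split
      · exact toCVec_mem_stateSpace C j (x t)
      · exact (stateSubmodule C N j).zero_mem
    have hsm : ∀ j, ContDiffOn ℝ ∞ (z j) (Ici 0) := fun j => by
      simp only [hz]
      split
      · exact contDiffOn_toCVec hx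
      · exact contDiffOn_const
    have hd : ∀ j, DifferentiableOn ℝ (z j) (Ici 0) := fun j =>
      (hsm j).differentiableOn (by simp)
    refine ⟨trackingConst F z, isIntegrationConstant_trackingConst hF hmem hd,
      fun hs => ⟨fun j => ?_, fun h => absurd ⟨h, hs⟩ hC⟩, z, isHierarchy_of_eq_trackingConst
        (fun j hj t _ => ?_) hmem hd fun _ _ _ => rfl⟩
    · exact (hs.contDiffOn_rateOp j (hmem j) (hsm j)).sub (contDiffOn_nextRe hsm j)
    · simp only [hz, hj, if_true, rePart_toCVec]

theorem theorem3 {n N M p : ℕ} (hn : 1 ≤ n) (sys : ControlSystem n N M)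
    (C : Finset (Fin p)) (hp : p + C.card = n)
    (Λ : Rates p N) (F : Fields p N) (hF : IsOpenIntegral C Λ F) :
    (∀ c, IsIntegrationConstant C c →
      IsOpenIntegral C Λ (addConst F c) ∧
      ∀ K : Controller N M, Enforces sys K C (addConst F c) →
        GlobalContraction C Λ (closedLoop sys K) (IsHierarchy C (addConst F c))) ∧
    (∀ xd : ℝ → RVec N, ContDiffOn ℝ ∞ xd (Ici 0) →
      ∃ c, IsIntegrationConstant C c ∧
        (SmoothFields C F → (∀ j, ContDiffOn ℝ ∞ (c j) (Ici 0)) ∧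
          (C = ∅ → ∀ j : Fin p, (j : ℕ) + 1 < p → c j = 0)) ∧
        CharacteristicEq C (addConst F c) xd ∧
        ∀ K : Controller N M, Enforces sys K C (addConst F c) →
          GlobalContraction C Λ (insert xd (closedLoop sys K))
            (IsHierarchy C (addConst F c))) := by
  -- Since `C.card ≤ p`, having `p = 0` would force `n = 0`. A first level is needed to compare the
  -- motions themselves.
  have hp0 : 0 < p := by
    have := Finset.card_le_univ C
    rw [Fintype.card_fin] at this
    omega
  refine ⟨fun c hc => ⟨hF.addConst hc, fun K hK =>
    globalContraction_of_characteristicEq (hF.addConst hc) hp0 hK⟩, fun xd hxd => ?_⟩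
  obtain ⟨c, hc, hsm, hchar⟩ := exists_integrationConstant_tracking hF hxd
  exact ⟨c, hc, hsm, hchar, fun K hK =>
    globalContraction_of_characteristicEq (hF.addConst hc) hp0
      (Set.forall_mem_insert.2 ⟨hchar, hK⟩)⟩
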